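/- Let $A_1,\dots,A_7,B_1,\dots,B_7$ be qubits. For $k=1,\dots,7$ let $P_\pm=\tfrac12(I\pm\mathrm{SWAP}_{A_kB_k})$ be the projectors onto the symmetric and the antisymmetric subspace of the pair $A_k,B_k$, where $\mathrm{SWAP}\,|v\rangle\otimes|w\rangle=|w\rangle\otimes|v\rangle$, and set $$\Phi_{\mathrm{E8}}=\sum_{i=0}^{3}x_i\,\mathcal P\big\{P_+^{\otimes(7-2i)}\otimes P_-^{\otimes 2i}\big\},\qquad x_0=\tfrac{113}{1119744},\quad x_1=\tfrac{17}{124416},\quad x_2=\tfrac1{13824},\quad x_3=\tfrac1{1536},$$ where $\mathcal P\{\cdot\}$ is the sum over all permutations of the seven tensor factors (one for each pair $A_kB_k$) that yield distinct terms. Then $\Phi_{\mathrm{E8}}$ is a quantum state (positive semidefinite with trace one) that is entangled across the bipartition $A_1\dots A_7\,|\,B_1\dots B_7$: it is not of the form $\sum_i p_i\,\sigma_i\otimes\tau_i$ with a finite sum, $p_i\ge 0$, $\sum_i p_i=1$, and quantum states $\sigma_i$ on $A_1\dots A_7$ and $\tau_i$ on $B_1\dots B_7$. Moreover, no absolutely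 maximally entangled state of seven qubits exists: there is no unit vector in $(\mathbb C^2)^{\otimes 7}$ all of whose three-qubit marginals are maximally mixed, that is, equal to $I/8$. -/

import Mathlib

open scoped ComplexOrder Kronecker

namespace PhiE8

/-- Computational basis labels of `n` qubits; operators on `(ℂ²)^{⊗n}` are matrices over this
index type. -/
abbrev Qubits (n : ℕ) : Type := Fin n → Fin 2

/-- A quantum state (density matrix) on the finite-dimensional space with basis `α`. -/
def IsDensityMatrix {α : Type*} [Fintype α] (ρ : Matrix α α ℂ) : Prop :=
  ρ.PosSemidef ∧ ρ.trace = 1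

/-- Separability across the bipartition `A | B`: the operator `ρ` on `ℂ^α ⊗ ℂ^β` is a finite
convex combination of products of states. -/
def IsSeparable {α β : Type*} [Fintype α] [Fintype β] (ρ : Matrix (α × β) (α × β) ℂ) : Prop :=
  ∃ (k : ℕ) (p : Fin k → ℝ) (σ : Fin k → Matrix α α ℂ) (τ : Fin k → Matrix β β ℂ),
    (∀ i, 0 ≤ p i) ∧ ∑ i, p i = 1 ∧
    (∀ i, IsDensityMatrix (σ i)) ∧ (∀ i, IsDensityMatrix (τ i)) ∧
    ρ = ∑ i, (p i : ℂ) • (σ i ⊗ₖ τ i)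

/-- A bipartite operator is an entangled state if it is a state and is not separable. -/
def IsEntangled {α β : Type*} [Fintype α] [Fintype β] (ρ : Matrix (α × β) (α × β) ℂ) : Prop :=
  IsDensityMatrix ρ ∧ ¬ IsSeparable ρ

/-- The swap operator of two qubits, `|v⟩ ⊗ |w⟩ ↦ |w⟩ ⊗ |v⟩`. -/
def swap : Matrix (Fin 2 × Fin 2) (Fin 2 × Fin 2) ℂ :=
  fun x y => if x = y.swap then 1 else 0

/-- The projector onto the symmetric subspace of a qubit pair. -/
noncomputable def projSym : Matrix (Fin 2 × Fin 2) (Fin 2 × Fin 2) ℂ :=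
  (1 / 2 : ℂ) • (1 + swap)

/-- The projector onto the antisymmetric subspace of a qubit pair. -/
noncomputable def projAnti : Matrix (Fin 2 × Fin 2) (Fin 2 × Fin 2) ℂ :=
  (1 / 2 : ℂ) • (1 - swap)

/-- The tensor product `⨂ₖ M k`, the operator `M k` acting on the pair `(Aₖ, Bₖ)`, as an operator
on `A₁…Aₙ ⊗ B₁…Bₙ`. -/
def pairTensor {n : ℕ} (M : Fin n → Matrix (Fin 2 × Fin 2) (Fin 2 × Fin 2) ℂ) :
    Matrix (Qubits n × Qubits n) (Qubits n × Qubits n) ℂ :=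
  fun x y => ∏ k, M k (x.1 k, x.2 k) (y.1 k, y.2 k)

/-- The sum of all distinct rearrangements of `P₊^{⊗(n-m)} ⊗ P₋^{⊗m}` over the `n` qubit pairs;
a rearrangement is given by the set `T` of the `m` positions that carry `P₋`. -/
noncomputable def symSum (n m : ℕ) : Matrix (Qubits n × Qubits n) (Qubits n × Qubits n) ℂ :=
  ∑ T ∈ (Finset.univ : Finset (Fin n)).powersetCard m,
    pairTensor (fun k => if k ∈ T then projAnti else projSym)

/-- The coefficients `x₀, x₁, x₂, x₃`. -/
noncomputable def coeff : Fin 4 → ℂ :=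
  ![113 / 1119744, 17 / 124416, 1 / 13824, 1 / 1536]

/-- The 14-qubit state `Φ_E8 = ∑ᵢ xᵢ 𝒫{P₊^{⊗(7-2i)} ⊗ P₋^{⊗2i}}` on `A₁…A₇ ⊗ B₁…B₇`. -/
noncomputable def phiE8 : Matrix (Qubits 7 × Qubits 7) (Qubits 7 × Qubits 7) ℂ :=
  ∑ i : Fin 4, coeff i • symSum 7 (2 * (i : ℕ))

/-- The basis label of `n` qubits that agrees with `a` on `S` and with `c` off `S`. -/
def glue {n : ℕ} (S : Finset (Fin n)) (a : {i // i ∈ S} → Fin 2) (c : {i // i ∉ S} → Fin 2) :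
    Qubits n :=
  fun i => if h : i ∈ S then a ⟨i, h⟩ else c ⟨i, h⟩

/-- The marginal on the qubits in `S`: the partial trace over the qubits not in `S`. -/
def marginal {n : ℕ} (S : Finset (Fin n)) (ρ : Matrix (Qubits n) (Qubits n) ℂ) :
    Matrix ({i // i ∈ S} → Fin 2) ({i // i ∈ S} → Fin 2) ℂ :=
  fun a b => ∑ c : {i // i ∉ S} → Fin 2, ρ (glue S a c) (glue S b c)

/-- A pure `n`-qubit state, given by a unit vector `ψ`, is absolutely maximally entangled if all
its marginals on `⌊n/2⌋` qubits are maximally mixed. -/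
def IsAME {n : ℕ} (ψ : Qubits n → ℂ) : Prop :=
  ∑ x, ‖ψ x‖ ^ 2 = 1 ∧
  ∀ S : Finset (Fin n), S.card = n / 2 →
    marginal S (Matrix.vecMulVec ψ (star ψ)) = ((1 / 2 : ℂ) ^ (n / 2)) • 1

end PhiE8

open scoped ComplexOrder Kronecker

namespace PhiE8

/-! Nonexistence. Let all three-qubit marginals of `ψ` be multiples of the identity and let `N` be
its squared norm. By Schmidt symmetry `ρ_T ⊗ 1` and the operator of the complementary marginal agree
on `ψ`, so `ψ` is an eigenvector of every `ρ_T ⊗ 1`. For a set `S` of five qubits the complementary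
marginal is maximally mixed, so `ρ_S² = (N/4) ρ_S`. The spin flip reverses products, hence its image
`Q` also satisfies `Q² = (N/4) Q`. But `Q` is the alternating sum of the `ρ_T ⊗ 1` over `T ⊆ S`
(`spinFlip_extMarginal`), which gives `Q ψ = (N/8) ψ`. Since `N/8` is neither `0` nor `N/4`, `ψ = 0`
(`eq_zero_of_marginal`).

Entanglement. The total swap has the same trace against `Φ_E8` as the identity, so in a separable
decomposition every product vector is symmetric, that is, of the form `l • a ⊗ a`
(`eq_swap_of_swapTrace`, `exists_smul_of_symm`). The swap on three pairs then measures the purity of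
a marginal of `a`. Its trace `1/8` is the least possible, so all three-qubit marginals of `a` are
maximally mixed when `l ≠ 0` (`marginal_of_swapTrace`), and `a = 0` by the first part. This
contradicts trace one. -/

/-! ### Marginals tensored with the identity -/

/-- The integral kernel of the superoperator `ρ ↦ ρ_T ⊗ 1`, where `ρ_T` is the marginal on `T`. -/
def kern {n : ℕ} (T : Finset (Fin n)) (x y u v : Qubits n) : ℂ :=
  ∏ k, if k ∈ T then (if x k = u k ∧ y k = v k then 1 else 0)
    else (if x k = y k ∧ u k = v k then 1 else 0)

/-- The operator `ρ_T ⊗ 1` on all `n` qubits. -/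
def extMarginal {n : ℕ} (T : Finset (Fin n)) (ρ : Matrix (Qubits n) (Qubits n) ℂ) :
    Matrix (Qubits n) (Qubits n) ℂ :=
  fun x y => ∑ s : Qubits n × Qubits n, kern T x y s.1 s.2 * ρ s.1 s.2

/-- Exchanging the two middle indices turns "same site value kept" into "site traced out"; this is
the index form of Schmidt symmetry. -/
lemma kern_compl {n : ℕ} (T : Finset (Fin n)) (x y u v : Qubits n) :
    kern Tᶜ x u y v = kern T x y u v := by
  unfold kern
  refine Finset.prod_congr rfl fun k _ => ?_
  by_cases h : k ∈ T <;> simp [h]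

lemma kern_eq_ite {n : ℕ} (T : Finset (Fin n)) (x y u v : Qubits n) :
    kern T x y u v = if (∀ k ∈ T, x k = u k ∧ y k = v k) ∧ (∀ k ∉ T, x k = y k ∧ u k = v k)
      then 1 else 0 := by
  have h : ∀ k, (if k ∈ T then (if x k = u k ∧ y k = v k then (1 : ℂ) else 0)
      else (if x k = y k ∧ u k = v k then 1 else 0)) =
      if (k ∈ T → x k = u k ∧ y k = v k) ∧ (k ∉ T → x k = y k ∧ u k = v k) then 1 else 0 := by
    intro k
    by_cases h : k ∈ T <;> simp [h]
  unfold kern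
  simp only [h, Finset.prod_ite_zero, Finset.prod_const_one, Finset.mem_univ, true_implies,
    forall_and]

/-- Splitting a basis label into its restrictions to `S` and to its complement. -/
def glueEquiv {n : ℕ} (S : Finset (Fin n)) :
    (({i // i ∈ S} → Fin 2) × ({i // i ∉ S} → Fin 2)) ≃ Qubits n where
  toFun p := glue S p.1 p.2
  invFun x := (fun i => x i, fun i => x i)
  left_inv p := by
    ext i
    · simp [glue]
    · simp [glue, i.2]
  right_inv x := by
    ext i
    by_cases h : i ∈ S <;> simp [glue, h]

lemma sum_glue {n : ℕ} {M : Type*} [AddCommMonoid M] (S : Finset (Fin n)) (f : Qubits n → M) :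
    ∑ x, f x = ∑ a, ∑ c, f (glue S a c) := by
  rw [← (glueEquiv S).sum_comp, Fintype.sum_prod_type]
  rfl

lemma kern_glue {n : ℕ} (T : Finset (Fin n)) (x y : Qubits n) (a b : {i // i ∈ T} → Fin 2)
    (c d : {i // i ∉ T} → Fin 2) :
    kern T x y (glue T a c) (glue T b d) =
      if (a = fun i : {i // i ∈ T} => x i) then if (b = fun i : {i // i ∈ T} => y i) then if c = d then
        if ∀ k ∉ T, x k = y k then 1 else 0 else 0 else 0 else 0 := by
  rw [kern_eq_ite]
  simp only [← ite_and]
  refine if_congr ?_ rfl rfl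
  constructor
  · rintro ⟨h1, h2⟩
    refine ⟨funext fun i => ?_, funext fun i => ?_, funext fun i => ?_, fun k hk => (h2 k hk).1⟩
    · simpa [glue] using (h1 i i.2).1.symm
    · simpa [glue] using (h1 i i.2).2.symm
    · simpa [glue, i.2] using (h2 i i.2).2
  · rintro ⟨rfl, rfl, rfl, h⟩
    exact ⟨fun k hk => by simp [glue, hk], fun k hk => ⟨h k hk, by simp [glue, hk]⟩⟩

lemma extMarginal_apply {n : ℕ} (T : Finset (Fin n)) (ρ : Matrix (Qubits n) (Qubits n) ℂ)
    (x y : Qubits n) :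
    extMarginal T ρ x y =
      if ∀ k ∉ T, x k = y k then marginal T ρ (fun i => x i) (fun i => y i) else 0 := by
  unfold extMarginal
  simp only [Fintype.sum_prod_type, sum_glue T, kern_glue, ite_mul, one_mul, zero_mul]
  rw [Finset.sum_eq_single (fun i : {i // i ∈ T} => x i)]
  · simp only [if_true]
    split_ifs with h
    · refine Finset.sum_congr rfl fun c _ => ?_
      rw [Finset.sum_eq_single (fun i : {i // i ∈ T} => y i)] <;> simp +contextual
    · simp
  · intro b _ hb
    simp [hb]
  · simp

lemma extMarginal_of_marginal {n : ℕ} {T : Finset (Fin n)} {ρ : Matrix (Qubits n) (Qubits n) ℂ}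
    {c : ℂ} (h : marginal T ρ = c • 1) : extMarginal T ρ = c • 1 := by
  ext x y
  rw [extMarginal_apply, h]
  simp only [Matrix.smul_apply, Matrix.one_apply, smul_eq_mul, mul_ite, mul_one, mul_zero]
  rw [← ite_and]
  refine if_congr ⟨fun ⟨h1, h2⟩ => funext fun k => ?_, fun h => by simp [h]⟩ rfl rfl
  by_cases hk : k ∈ T
  · exact congrFun h2 ⟨k, hk⟩
  · exact h1 k hk

lemma extMarginal_mulVec {n : ℕ} {T : Finset (Fin n)} {ψ : Qubits n → ℂ} {c : ℂ}
    (h : extMarginal Tᶜ (Matrix.vecMulVec ψ (star ψ)) = c • 1) :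
    (extMarginal T (Matrix.vecMulVec ψ (star ψ))).mulVec ψ = c • ψ := by
  ext x
  have key : (extMarginal T (Matrix.vecMulVec ψ (star ψ))).mulVec ψ x =
      ((extMarginal Tᶜ (Matrix.vecMulVec ψ (star ψ))).mulVec ψ) x := by
    simp only [Matrix.mulVec, dotProduct, extMarginal, Fintype.sum_prod_type, Finset.sum_mul, Matrix.vecMulVec_apply]
    rw [Finset.sum_comm]
    refine Finset.sum_congr rfl fun u _ => Finset.sum_congr rfl fun y _ =>
      Finset.sum_congr rfl fun v _ => ?_
    rw [kern_compl]
    ring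
  rw [key, h, Matrix.smul_mulVec, Matrix.one_mulVec]

/-- Both sides factor over the sites, so a one-qubit identity suffices. -/
lemma sum_kern_mul_kern {n : ℕ} (T : Finset (Fin n)) (x y p q u v : Qubits n) :
    ∑ z, kern T x z p q * kern T z y u v = ∑ w, kern T x y w v * kern T w u p q := by
  simp only [kern, ← Finset.prod_mul_distrib]
  have h1 := Finset.prod_univ_sum (fun _ : Fin n => (Finset.univ : Finset (Fin 2)))
    (fun k b => (if k ∈ T then (if x k = p k ∧ b = q k then (1 : ℂ) else 0)
    else (if x k = b ∧ p k = q k then 1 else 0)) * (if k ∈ T then (if b = u k ∧ y k = v k then 1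
      else 0) else (if b = y k ∧ u k = v k then 1 else 0)))
  have h2 := Finset.prod_univ_sum (fun _ : Fin n => (Finset.univ : Finset (Fin 2)))
    (fun k b => (if k ∈ T then (if x k = b ∧ y k = v k then (1 : ℂ) else 0)
    else (if x k = y k ∧ b = v k then 1 else 0)) * (if k ∈ T then (if b = p k ∧ u k = q k then 1
      else 0) else (if b = u k ∧ p k = q k then 1 else 0)))
  rw [Fintype.piFinset_univ] at h1 h2
  rw [← h1, ← h2]
  refine Finset.prod_congr rfl fun k _ => ?_
  clear h1 h2
  generalize x k = x, y k = y, p k = p, q k = q, u k = u, v k = v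
  by_cases h : k ∈ T
  · simp only [h, if_true]
    by_cases h1 : x = p <;> by_cases h2 : y = v <;> by_cases h3 : q = u <;>
      simp [h1, h2, h3, Ne.symm]
  · simp only [h, if_false]
    by_cases h1 : x = y <;> by_cases h2 : p = q <;> by_cases h3 : u = v <;>
      simp [h1, h2, h3, eq_comm]

/-- An operator acting only on `T` can be pulled through the partial trace over the complement of
`T`. -/
lemma extMarginal_mul {n : ℕ} (T : Finset (Fin n)) (ρ ρ' : Matrix (Qubits n) (Qubits n) ℂ) :
    extMarginal T ρ * extMarginal T ρ' = extMarginal T (extMarginal T ρ * ρ') := by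
  ext x y
  have hl : (extMarginal T ρ * extMarginal T ρ') x y =
      ∑ s : Qubits n × Qubits n, ∑ t : Qubits n × Qubits n,
        (∑ z, kern T x z t.1 t.2 * kern T z y s.1 s.2) * (ρ t.1 t.2 * ρ' s.1 s.2) := by
    simp only [Matrix.mul_apply, extMarginal, Finset.sum_mul_sum]
    refine Finset.sum_comm.trans ((Finset.sum_congr rfl fun t _ => Finset.sum_comm).trans ?_)
    refine Finset.sum_comm.trans ?_
    refine Finset.sum_congr rfl fun s _ => Finset.sum_congr rfl fun t _ => ?_
    rw [Finset.sum_mul]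
    exact Finset.sum_congr rfl fun z _ => by ring
  have hr : (extMarginal T (extMarginal T ρ * ρ')) x y =
      ∑ s : Qubits n × Qubits n, ∑ t : Qubits n × Qubits n,
        (∑ w, kern T x y w s.2 * kern T w s.1 t.1 t.2) * (ρ t.1 t.2 * ρ' s.1 s.2) := by
    simp only [Matrix.mul_apply, extMarginal]
    simp only [Fintype.sum_prod_type (f := fun s : Qubits n × Qubits n => kern T x y s.1 s.2 * _),
      Fintype.sum_prod_type (f := fun s : Qubits n × Qubits n =>
        ∑ t : Qubits n × Qubits n, (∑ w, kern T x y w s.2 * _) * _)]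
    rw [Finset.sum_comm, Finset.sum_comm (γ := Qubits n) (s := Finset.univ) (t := Finset.univ)
      (f := fun u v => ∑ t : Qubits n × Qubits n, _)]
    refine Finset.sum_congr rfl fun v _ => ?_
    simp only [Finset.mul_sum, Finset.sum_mul]
    rw [Finset.sum_comm]
    refine Finset.sum_congr rfl fun u _ => ?_
    rw [Finset.sum_comm]
    exact Finset.sum_congr rfl fun t _ => Finset.sum_congr rfl fun w _ => by ring
  rw [hl, hr]
  simp only [sum_kern_mul_kern]

/-- The factor `2` is the trace of the one-qubit identity at `j`. -/
lemma extMarginal_erase {n : ℕ} {T : Finset (Fin n)} {ρ : Matrix (Qubits n) (Qubits n) ℂ} {c : ℂ}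
    {j : Fin n} (hj : j ∈ T) (h : extMarginal T ρ = c • 1) :
    extMarginal (T.erase j) ρ = (2 * c) • 1 := by
  have key : ∀ x y u v : Qubits n, kern (T.erase j) x y u v = if x j = y j then
      ∑ b, kern T (Function.update x j b) (Function.update y j b) u v else 0 := by
    intro x y u v
    simp only [kern, ← Finset.mul_prod_erase Finset.univ _ (Finset.mem_univ j)]
    have h1 : ∀ b, ∏ k ∈ Finset.univ.erase j, (if k ∈ T then
        (if Function.update x j b k = u k ∧ Function.update y j b k = v k then (1 : ℂ) else 0)
        else (if Function.update x j b k = Function.update y j b k ∧ u k = v k then 1 else 0)) =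
        ∏ k ∈ Finset.univ.erase j, (if k ∈ T.erase j then
        (if x k = u k ∧ y k = v k then (1 : ℂ) else 0)
        else (if x k = y k ∧ u k = v k then 1 else 0)) := by
      intro b
      refine Finset.prod_congr rfl fun k hk => ?_
      have hk' := Finset.ne_of_mem_erase hk
      simp [hk']
    simp only [h1, ← Finset.sum_mul]
    by_cases h2 : x j = y j <;> by_cases h3 : u j = v j <;> simp [h2, h3, hj, ite_and]
  have key2 : ∀ x y, extMarginal (T.erase j) ρ x y = if x j = y j then
      ∑ b, extMarginal T ρ (Function.update x j b) (Function.update y j b) else 0 := by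
    intro x y
    simp only [extMarginal, key]
    split_ifs with h
    · simp only [Finset.sum_mul]
      exact Finset.sum_comm
    · simp
  ext x y
  rw [key2, h]
  simp only [Matrix.smul_apply, Matrix.one_apply, smul_eq_mul, mul_ite, mul_one, mul_zero]
  by_cases hxy : x = y
  · simp [hxy, two_mul]
  · rw [if_neg hxy]
    split_ifs with h1
    · refine Finset.sum_eq_zero fun b _ => if_neg fun h2 => hxy (funext fun k => ?_)
      by_cases hk : k = j
      · rw [hk, h1]
      · simpa [hk] using congrFun h2 k
    · rfl

/-! ### The spin flip -/

/-- The bit flip of all qubits. -/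
def flipBits {n : ℕ} (x : Qubits n) : Qubits n := fun k => (x k).rev

lemma flipBits_flipBits {n : ℕ} (x : Qubits n) : flipBits (flipBits x) = x :=
  funext fun _ => Fin.rev_rev _

/-- The sign `∏_{k ∈ S} (-1)^{x k}`. -/
def bitSign {n : ℕ} (S : Finset (Fin n)) (x : Qubits n) : ℂ := ∏ k ∈ S, (-1) ^ (x k : ℕ)

lemma bitSign_mul_self {n : ℕ} (S : Finset (Fin n)) (x : Qubits n) :
    bitSign S x * bitSign S x = 1 := by
  unfold bitSign
  rw [← Finset.prod_mul_distrib]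
  exact Finset.prod_eq_one fun k _ => by rw [← mul_pow]; simp

/-- The spin flip `R ↦ Y^{⊗S} Rᵀ Y^{⊗S}` of an operator `R` acting on the qubits in `S`. -/
def spinFlip {n : ℕ} (S : Finset (Fin n)) (R : Matrix (Qubits n) (Qubits n) ℂ) :
    Matrix (Qubits n) (Qubits n) ℂ :=
  fun x y => bitSign S x * bitSign S y * R (flipBits y) (flipBits x)

/-- The transpose reverses the product, and the signs at the summation index cancel in pairs. -/
lemma spinFlip_mul {n : ℕ} (S : Finset (Fin n)) (R R' : Matrix (Qubits n) (Qubits n) ℂ) :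
    spinFlip S R * spinFlip S R' = spinFlip S (R' * R) := by
  ext x y
  simp only [Matrix.mul_apply, spinFlip, Finset.mul_sum]
  refine Fintype.sum_equiv (Function.Involutive.toPerm flipBits flipBits_flipBits) _ _ fun z => ?_
  change _ = bitSign S x * bitSign S y *
    (R' (flipBits y) (flipBits z) * R (flipBits z) (flipBits x))
  linear_combination (bitSign S x * bitSign S y * R (flipBits z) (flipBits x) *
    R' (flipBits y) (flipBits z)) * bitSign_mul_self S z

lemma spinFlip_smul {n : ℕ} (S : Finset (Fin n)) (c : ℂ) (R : Matrix (Qubits n) (Qubits n) ℂ) :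
    spinFlip S (c • R) = c • spinFlip S R := by
  ext x y
  simp only [spinFlip, Matrix.smul_apply, smul_eq_mul]
  ring

lemma kern_eq_prod_mul_prod {n : ℕ} {T S : Finset (Fin n)} (h : T ⊆ S) (x y u v : Qubits n) :
    kern T x y u v = (∏ k ∈ T, if x k = u k ∧ y k = v k then 1 else 0) *
      (∏ k ∈ S \ T, if x k = y k ∧ u k = v k then 1 else 0) *
      ∏ k ∈ Sᶜ, if x k = y k ∧ u k = v k then 1 else 0 := by
  unfold kern
  rw [← Finset.prod_mul_prod_compl S, ← Finset.prod_sdiff h, mul_comm (∏ k ∈ S \ T, _)]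
  congr 1
  · congr 1
    · exact Finset.prod_congr rfl fun k hk => if_pos hk
    · exact Finset.prod_congr rfl fun k hk => if_neg (Finset.mem_sdiff.1 hk).2
  · exact Finset.prod_congr rfl fun k hk => if_neg fun hT => Finset.mem_compl.1 hk (h hT)

/-- One-qubit case: `Y Rᵀ Y = tr(R) 1 - R`. Expanding its product over `S` gives the alternating sum
over subsets. -/
lemma site_spinFlip (x y u v : Fin 2) :
    (-1 : ℂ) ^ (x : ℕ) * (-1) ^ (y : ℕ) * (if y.rev = u ∧ x.rev = v then 1 else 0) =
      -(if x = u ∧ y = v then 1 else 0) + (if x = y ∧ u = v then 1 else 0) := by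
  have h : ∀ x y u v : Fin 2,
      (-1 : ℤ) ^ (x : ℕ) * (-1) ^ (y : ℕ) * (if y.rev = u ∧ x.rev = v then 1 else 0) =
      -(if x = u ∧ y = v then 1 else 0) + (if x = y ∧ u = v then 1 else 0) := by decide
  exact_mod_cast congrArg (Int.cast : ℤ → ℂ) (h x y u v)

lemma bitSign_mul_kern {n : ℕ} (S : Finset (Fin n)) (x y u v : Qubits n) :
    bitSign S x * bitSign S y * kern S (flipBits y) (flipBits x) u v =
      ∑ T ∈ S.powerset, (-1) ^ T.card * kern T x y u v := by
  have h : ∀ T ∈ S.powerset, (-1) ^ T.card * kern T x y u v =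
      (∏ k ∈ T, -(if x k = u k ∧ y k = v k then (1 : ℂ) else 0)) *
      (∏ k ∈ S \ T, if x k = y k ∧ u k = v k then 1 else 0) *
      ∏ k ∈ Sᶜ, if x k = y k ∧ u k = v k then 1 else 0 := by
    intro T hT
    rw [kern_eq_prod_mul_prod (Finset.mem_powerset.1 hT), Finset.prod_neg]
    ring
  rw [Finset.sum_congr rfl h, ← Finset.sum_mul, ← Finset.prod_add,
    kern_eq_prod_mul_prod (Finset.Subset.refl S), Finset.sdiff_self, Finset.prod_empty, mul_one,
    ← mul_assoc]
  unfold bitSign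
  rw [← Finset.prod_mul_distrib, ← Finset.prod_mul_distrib]
  congr 1
  · exact Finset.prod_congr rfl fun k _ => site_spinFlip _ _ _ _
  · refine Finset.prod_congr rfl fun k _ => if_congr ?_ rfl rfl
    simp [flipBits, eq_comm]

/-- The spin flip of a marginal is an alternating sum of smaller marginals. -/
lemma spinFlip_extMarginal {n : ℕ} (S : Finset (Fin n)) (ρ : Matrix (Qubits n) (Qubits n) ℂ) :
    spinFlip S (extMarginal S ρ) = ∑ T ∈ S.powerset, (-1 : ℂ) ^ T.card • extMarginal T ρ := by
  ext x y
  simp only [spinFlip, Matrix.sum_apply, Matrix.smul_apply, extMarginal, smul_eq_mul,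
    Finset.mul_sum, ← mul_assoc]
  rw [Finset.sum_comm]
  refine Finset.sum_congr rfl fun s _ => ?_
  rw [bitSign_mul_kern, Finset.sum_mul]

/-! ### No absolutely maximally entangled state of seven qubits -/

lemma extMarginal_smul {n : ℕ} (T : Finset (Fin n)) (c : ℂ) (ρ : Matrix (Qubits n) (Qubits n) ℂ) :
    extMarginal T (c • ρ) = c • extMarginal T ρ := by
  ext x y
  simp only [extMarginal, Matrix.smul_apply, smul_eq_mul, Finset.mul_sum]
  exact Finset.sum_congr rfl fun s _ => by ring

lemma extMarginal_mul_self {n : ℕ} {T : Finset (Fin n)} {ψ : Qubits n → ℂ} {c : ℂ}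
    (h : extMarginal Tᶜ (Matrix.vecMulVec ψ (star ψ)) = c • 1) :
    extMarginal T (Matrix.vecMulVec ψ (star ψ)) * extMarginal T (Matrix.vecMulVec ψ (star ψ)) =
      c • extMarginal T (Matrix.vecMulVec ψ (star ψ)) := by
  rw [extMarginal_mul, Matrix.mul_vecMulVec, extMarginal_mulVec h, Matrix.smul_vecMulVec,
    extMarginal_smul]

lemma extMarginal_of_card_le {n : ℕ} {ρ : Matrix (Qubits n) (Qubits n) ℂ} {m : ℕ} (hm : m ≤ n)
    {N : ℂ} (h : ∀ S : Finset (Fin n), S.card = m → extMarginal S ρ = (N / 2 ^ m) • 1)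
    {T : Finset (Fin n)} (hT : T.card ≤ m) : extMarginal T ρ = (N / 2 ^ T.card) • 1 := by
  obtain ⟨d, hd⟩ := Nat.exists_eq_add_of_le hT
  induction d generalizing T with
  | zero => rw [h T (by omega), show T.card = m by omega]
  | succ d ih =>
    obtain ⟨j, hj⟩ : ∃ j, j ∉ T := by
      by_contra! hall
      have : T = Finset.univ := Finset.eq_univ_iff_forall.2 hall
      rw [this, Finset.card_univ, Fintype.card_fin] at hd
      omega
    have hc : (insert j T).card = T.card + 1 := Finset.card_insert_of_notMem hj
    have := extMarginal_erase (Finset.mem_insert_self j T) (ih (by omega) (by omega))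
    rw [Finset.erase_insert hj, hc] at this
    rw [this]
    congr 1
    rw [pow_succ]
    field_simp

/-- A vector of seven qubits all of whose three-qubit marginals are a common nonzero multiple of the identity
vanishes. -/
theorem eq_zero_of_marginal {ψ : Qubits 7 → ℂ} {N : ℂ} (hN : N ≠ 0)
    (h : ∀ S : Finset (Fin 7), S.card = 3 →
      marginal S (Matrix.vecMulVec ψ (star ψ)) = (N / 2 ^ 3) • 1) : ψ = 0 := by
  set ρ := Matrix.vecMulVec ψ (star ψ) with hρ
  have hle : ∀ T : Finset (Fin 7), T.card ≤ 3 → extMarginal T ρ = (N / 2 ^ T.card) • 1 :=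
    fun T hT => extMarginal_of_card_le (by norm_num) (fun S hS => extMarginal_of_marginal (h S hS)) hT
  have hcompl : ∀ T : Finset (Fin 7), T.card = 7 - Tᶜ.card := fun T => by
    have := Finset.card_add_card_compl T
    rw [Fintype.card_fin] at this
    omega
  let S : Finset (Fin 7) := {0, 1, 2, 3, 4}
  have hS : S.card = 5 := rfl
  have hSc : extMarginal Sᶜ ρ = (N / 4) • 1 := by
    rw [hle _ (by decide), show Sᶜ.card = 2 by decide]; norm_num
  -- Of `T` and its complement exactly one has at most three qubits; its size determines the
  -- eigenvalue.
  let g : ℕ → ℂ := fun m => if m ≤ 3 then N / 2 ^ m else N / 2 ^ (7 - m)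
  have heig : ∀ T : Finset (Fin 7), (extMarginal T ρ).mulVec ψ = g T.card • ψ := by
    intro T
    by_cases hT : T.card ≤ 3
    · rw [hle T hT, Matrix.smul_mulVec, Matrix.one_mulVec]
      simp only [g, if_pos hT]
    · have := hcompl T
      have := hcompl Tᶜ
      rw [compl_compl] at this
      rw [extMarginal_mulVec (hle Tᶜ (by omega))]
      simp only [g, if_neg hT]
      rw [this]
  set Q := spinFlip S (extMarginal S ρ) with hQ
  have hQψ : Q.mulVec ψ = (N / 8) • ψ := by
    rw [hQ, spinFlip_extMarginal, Matrix.sum_mulVec]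
    simp only [Matrix.smul_mulVec, heig, smul_smul]
    -- The eigenvalue is `N (1 - 5/2 + 10/4 - 10/8 + 5/8 - 1/4) = N/8`.
    rw [← Finset.sum_smul, Finset.sum_powerset_apply_card (fun m => (-1) ^ m * g m), hS]
    congr 1
    simp [Finset.sum_range_succ, g, Nat.choose]
    ring
  have hQQ : Q * Q = (N / 4) • Q := by
    rw [hQ, spinFlip_mul, extMarginal_mul_self hSc, spinFlip_smul]
  have h1 : Q.mulVec (Q.mulVec ψ) = (N / 4) • Q.mulVec ψ := by
    rw [Matrix.mulVec_mulVec, hQQ, Matrix.smul_mulVec]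
  rw [hQψ, Matrix.mulVec_smul, hQψ, smul_smul, smul_smul, ← sub_eq_zero, ← sub_smul] at h1
  refine (smul_eq_zero.1 h1).resolve_left ?_
  have : N / 8 * (N / 8) - N / 4 * (N / 8) = -(N * N / 64) := by ring
  rw [this]
  simp [hN]

theorem not_isAME_seven (ψ : Qubits 7 → ℂ) : ¬ IsAME ψ := by
  rintro ⟨h1, h2⟩
  have h0 : ψ = 0 := by
    refine eq_zero_of_marginal one_ne_zero fun S hS => ?_
    rw [h2 S hS]
    norm_num
  simp [h0] at h1

/-! ### Swap traces of `Φ_E8` -/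

/-- Exchanging `Aₖ` and `Bₖ` for all `k ∈ S` in a basis label of `A₁…Aₙ ⊗ B₁…Bₙ`. -/
def swapOn {n : ℕ} (S : Finset (Fin n)) (x : Qubits n × Qubits n) : Qubits n × Qubits n :=
  (fun k => if k ∈ S then x.2 k else x.1 k, fun k => if k ∈ S then x.1 k else x.2 k)

/-- The trace of `Φ` times the operator that swaps `Aₖ` and `Bₖ` for all `k ∈ S`. -/
def swapTrace {n : ℕ} (S : Finset (Fin n))
    (Φ : Matrix (Qubits n × Qubits n) (Qubits n × Qubits n) ℂ) : ℂ :=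
  ∑ x, Φ (swapOn S x) x

lemma swapOn_empty {n : ℕ} (x : Qubits n × Qubits n) : swapOn ∅ x = x := by simp [swapOn]

lemma swapOn_univ {n : ℕ} (x : Qubits n × Qubits n) : swapOn Finset.univ x = x.swap := by
  simp [swapOn, Prod.swap]

lemma swapTrace_empty {n : ℕ} (Φ : Matrix (Qubits n × Qubits n) (Qubits n × Qubits n) ℂ) :
    swapTrace ∅ Φ = Φ.trace := by
  simp [swapTrace, swapOn_empty, Matrix.trace]

lemma sum_prod_pairs {n : ℕ} (f : Fin n → Fin 2 × Fin 2 → ℂ) :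
    ∑ x : Qubits n × Qubits n, ∏ k, f k (x.1 k, x.2 k) = ∏ k, ∑ p, f k p := by
  rw [Finset.prod_univ_sum, Fintype.piFinset_univ]
  exact Fintype.sum_equiv (Equiv.arrowProdEquivProdArrow (Fin n) (fun _ => Fin 2)
    (fun _ => Fin 2)).symm _ _ fun x => rfl

lemma swapTrace_pairTensor {n : ℕ} (S : Finset (Fin n))
    (M : Fin n → Matrix (Fin 2 × Fin 2) (Fin 2 × Fin 2) ℂ) :
    swapTrace S (pairTensor M) = ∏ k, ∑ p, M k (if k ∈ S then p.swap else p) p := by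
  rw [← sum_prod_pairs]
  refine Finset.sum_congr rfl fun x _ => Finset.prod_congr rfl fun k _ => ?_
  by_cases h : k ∈ S <;> simp [swapOn, h]

lemma swapTrace_sum {n : ℕ} {ι : Type*} (S : Finset (Fin n)) (s : Finset ι)
    (Φ : ι → Matrix (Qubits n × Qubits n) (Qubits n × Qubits n) ℂ) :
    swapTrace S (∑ i ∈ s, Φ i) = ∑ i ∈ s, swapTrace S (Φ i) := by
  simp only [swapTrace, Matrix.sum_apply]
  exact Finset.sum_comm

lemma swapTrace_smul {n : ℕ} (S : Finset (Fin n)) (c : ℂ)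
    (Φ : Matrix (Qubits n × Qubits n) (Qubits n × Qubits n) ℂ) :
    swapTrace S (c • Φ) = c * swapTrace S Φ := by
  simp only [swapTrace, Matrix.smul_apply, smul_eq_mul, Finset.mul_sum]

lemma site_swapTrace (s t : Prop) [Decidable s] [Decidable t] :
    ∑ p, (if t then projAnti else projSym) (if s then p.swap else p) p =
      if t then (if s then -1 else 1) else 3 := by
  by_cases hs : s <;> by_cases ht : t <;>
    simp [hs, ht, Fintype.sum_prod_type, projAnti, projSym, swap, Matrix.one_apply] <;> norm_num

lemma swapTrace_symSum {n : ℕ} (S : Finset (Fin n)) (m : ℕ) :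
    swapTrace S (symSum n m) = 3 ^ (n - m) *
      ((∑ T ∈ (Finset.univ : Finset (Fin n)).powersetCard m, (-1) ^ (T ∩ S).card : ℤ) : ℂ) := by
  rw [symSum, swapTrace_sum, Int.cast_sum, Finset.mul_sum]
  refine Finset.sum_congr rfl fun T hT => ?_
  rw [swapTrace_pairTensor]
  simp only [site_swapTrace]
  rw [← Finset.prod_mul_prod_compl T,
    Finset.prod_congr rfl (g := fun k => if k ∈ S then (-1 : ℂ) else 1) (fun k hk => if_pos hk),
    Finset.prod_congr rfl (s₁ := Tᶜ) (g := fun _ => (3 : ℂ))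
      (fun k hk => if_neg (Finset.mem_compl.1 hk)),
    Finset.prod_const, Finset.card_compl, Fintype.card_fin, (Finset.mem_powersetCard.1 hT).2,
    Finset.prod_ite]
  simp [Finset.filter_mem_eq_inter, mul_comm]

lemma swapTrace_phiE8 (S : Finset (Fin 7)) :
    swapTrace S phiE8 = ∑ i : Fin 4, coeff i * (3 ^ (7 - 2 * (i : ℕ)) *
      ((∑ T ∈ (Finset.univ : Finset (Fin 7)).powersetCard (2 * i), (-1) ^ (T ∩ S).card : ℤ) : ℂ)) := by
  simp only [phiE8, swapTrace_sum, swapTrace_smul, swapTrace_symSum]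

/-- These are the even coefficients of `(1 - z)³ (1 + z)⁴ = (1 - z²)³ (1 + z)`. -/
lemma sum_powersetCard_three : ∀ S ∈ (Finset.univ : Finset (Fin 7)).powersetCard 3, ∀ i : Fin 4,
    ∑ T ∈ (Finset.univ : Finset (Fin 7)).powersetCard (2 * i), (-1 : ℤ) ^ (T ∩ S).card =
      ![1, -3, 3, -1] i := by
  decide +kernel

lemma swapTrace_phiE8_of_card_eq_three {S : Finset (Fin 7)} (hS : S.card = 3) :
    swapTrace S phiE8 = 1 / 8 := by
  rw [swapTrace_phiE8]
  simp only [sum_powersetCard_three S (by simpa using hS)]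
  simp [Fin.sum_univ_four, coeff]
  norm_num

lemma swapTrace_phiE8_univ : swapTrace Finset.univ phiE8 = 1 := by
  have h : ∀ i : Fin 4, ∑ T ∈ (Finset.univ : Finset (Fin 7)).powersetCard (2 * i),
      (-1 : ℤ) ^ (T ∩ Finset.univ).card = ![1, 21, 35, 7] i := by decide +kernel
  rw [swapTrace_phiE8]
  simp only [h]
  simp [Fin.sum_univ_four, coeff]
  norm_num

lemma swapTrace_phiE8_empty : swapTrace ∅ phiE8 = 1 := by
  have h : ∀ i : Fin 4, ∑ T ∈ (Finset.univ : Finset (Fin 7)).powersetCard (2 * i),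
      (-1 : ℤ) ^ (T ∩ ∅).card = ![1, 21, 35, 7] i := by decide +kernel
  rw [swapTrace_phiE8]
  simp only [h]
  simp [Fin.sum_univ_four, coeff]
  norm_num

/-! ### `Φ_E8` is a state -/

lemma pairTensor_mul {n : ℕ} (M N : Fin n → Matrix (Fin 2 × Fin 2) (Fin 2 × Fin 2) ℂ) :
    pairTensor M * pairTensor N = pairTensor (fun k => M k * N k) := by
  ext x y
  simp only [Matrix.mul_apply, pairTensor, ← Finset.prod_mul_distrib]
  exact sum_prod_pairs fun k p => M k (x.1 k, x.2 k) p * N k p (y.1 k, y.2 k)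

lemma pairTensor_conjTranspose {n : ℕ} (M : Fin n → Matrix (Fin 2 × Fin 2) (Fin 2 × Fin 2) ℂ) :
    (pairTensor M).conjTranspose = pairTensor (fun k => (M k).conjTranspose) := by
  ext x y
  simp [pairTensor]

lemma swap_mul_swap : swap * swap = 1 := by
  ext x y
  simp [Matrix.mul_apply, swap, Matrix.one_apply]

lemma swap_conjTranspose : swap.conjTranspose = swap := by
  ext x y
  simp only [Matrix.conjTranspose_apply, swap]
  by_cases h : x = y.swap
  · simp [h]
  · have : y ≠ x.swap := fun h' => h (by rw [h', Prod.swap_swap])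
    simp [h, this]

lemma projSym_conjTranspose_mul_self : projSym.conjTranspose * projSym = projSym := by
  have : ((1 + swap) * (1 + swap) : Matrix _ _ ℂ) = (2 : ℂ) • (1 + swap) := by
    rw [mul_add, add_mul, add_mul, swap_mul_swap, two_smul]
    simp
    abel
  rw [projSym, Matrix.conjTranspose_smul, Matrix.conjTranspose_add, Matrix.conjTranspose_one,
    swap_conjTranspose, smul_mul_smul_comm, this, smul_smul]
  norm_num

lemma projAnti_conjTranspose_mul_self : projAnti.conjTranspose * projAnti = projAnti := by
  have : ((1 - swap) * (1 - swap) : Matrix _ _ ℂ) = (2 : ℂ) • (1 - swap) := by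
    rw [mul_sub, sub_mul, sub_mul, swap_mul_swap, two_smul]
    simp
    abel
  rw [projAnti, Matrix.conjTranspose_smul, Matrix.conjTranspose_sub, Matrix.conjTranspose_one,
    swap_conjTranspose, smul_mul_smul_comm, this, smul_smul]
  norm_num

lemma symSum_posSemidef (n m : ℕ) : (symSum n m).PosSemidef := by
  refine Matrix.posSemidef_sum _ fun T _ => ?_
  have h : pairTensor (fun k => if k ∈ T then projAnti else projSym) =
      (pairTensor (fun k => if k ∈ T then projAnti else projSym)).conjTranspose *
        pairTensor (fun k => if k ∈ T then projAnti else projSym) := by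
    rw [pairTensor_conjTranspose, pairTensor_mul]
    congr 1
    ext1 k
    by_cases hk : k ∈ T
    · simp only [hk, if_true, projAnti_conjTranspose_mul_self]
    · simp only [hk, if_false, projSym_conjTranspose_mul_self]
  rw [h]
  exact Matrix.posSemidef_conjTranspose_mul_self _

theorem phiE8_isDensityMatrix : IsDensityMatrix phiE8 := by
  refine ⟨Matrix.posSemidef_sum _ fun i _ => (symSum_posSemidef 7 _).smul ?_, ?_⟩
  · fin_cases i <;> simp [coeff] <;> positivity
  · rw [← swapTrace_empty, swapTrace_phiE8_empty]

/-! ### `Φ_E8` is not separable -/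

open scoped MatrixOrder Matrix.Norms.L2Operator in
/-- A separable operator is a sum of projections onto unnormalized product vectors. -/
lemma IsSeparable.exists_vectors {α β : Type} [Fintype α] [Fintype β]
    {ρ : Matrix (α × β) (α × β) ℂ} (h : IsSeparable ρ) :
    ∃ (ι : Type) (_ : Fintype ι) (a : ι → α → ℂ) (b : ι → β → ℂ), ∀ x y,
      ρ x y = ∑ j, a j x.1 * b j x.2 * star (a j y.1 * b j y.2) := by
  classical
  obtain ⟨k, p, σ, τ, hp, -, hσ, hτ, rfl⟩ := h
  have hB : ∀ i, ∃ B : Matrix α α ℂ, σ i = B.conjTranspose * B := fun i =>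
    CStarAlgebra.nonneg_iff_eq_star_mul_self.1 (hσ i).1.nonneg
  have hC : ∀ i, ∃ C : Matrix β β ℂ, τ i = C.conjTranspose * C := fun i =>
    CStarAlgebra.nonneg_iff_eq_star_mul_self.1 (hτ i).1.nonneg
  choose B hB using hB
  choose C hC using hC
  -- The vectors are the conjugated rows of the factors `B` and `C`; the weight goes entirely into
  -- the first vector.
  refine ⟨Fin k × α × β, inferInstance, fun j x => (Real.sqrt (p j.1) : ℂ) * star (B j.1 j.2.1 x),
    fun j y => star (C j.1 j.2.2 y), fun x y => ?_⟩
  simp only [Matrix.sum_apply, Matrix.smul_apply, Matrix.kroneckerMap_apply, Fintype.sum_prod_type]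
  refine Finset.sum_congr rfl fun i _ => ?_
  rw [hB i, hC i, Matrix.mul_apply, Matrix.mul_apply, Finset.sum_mul_sum, Finset.smul_sum]
  refine Finset.sum_congr rfl fun s _ => ?_
  rw [Finset.smul_sum]
  refine Finset.sum_congr rfl fun t _ => ?_
  have hs : (p i : ℂ) = (Real.sqrt (p i) : ℂ) * (Real.sqrt (p i) : ℂ) := by
    rw [← Complex.ofReal_mul, Real.mul_self_sqrt (hp i)]
  rw [hs]
  simp
  ring

lemma swapOn_glue {n : ℕ} (S : Finset (Fin n)) (s t : {i // i ∈ S} → Fin 2)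
    (w z : {i // i ∉ S} → Fin 2) :
    swapOn S (glue S s w, glue S t z) = (glue S t w, glue S s z) := by
  ext k <;> by_cases h : k ∈ S <;> simp [swapOn, glue, h]

/-- Swap trick: swapping the part `S` of two copies of a pure state computes the purity of its
marginal on `S`. -/
lemma sum_swapOn_eq {n : ℕ} (S : Finset (Fin n)) (a : Qubits n → ℂ) :
    ∑ x : Qubits n × Qubits n, a (swapOn S x).1 * a (swapOn S x).2 * star (a x.1 * a x.2) =
      ∑ s, ∑ t, marginal S (Matrix.vecMulVec a (star a)) s t *
        star (marginal S (Matrix.vecMulVec a (star a)) s t) := by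
  simp only [Fintype.sum_prod_type, sum_glue S, swapOn_glue]
  refine Finset.sum_congr rfl fun s _ => ?_
  rw [Finset.sum_comm]
  refine Finset.sum_congr rfl fun t _ => ?_
  simp only [marginal, Matrix.vecMulVec_apply, star_sum, Finset.sum_mul_sum]
  rw [Finset.sum_comm]
  refine Finset.sum_congr rfl fun z _ => Finset.sum_congr rfl fun w _ => ?_
  simp
  ring

lemma sum_marginal_diag {n : ℕ} (S : Finset (Fin n)) (a : Qubits n → ℂ) :
    ∑ s, marginal S (Matrix.vecMulVec a (star a)) s s = ∑ x, a x * star (a x) := by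
  rw [sum_glue S]
  rfl

/-- The deviation of the purity of a marginal from that of the maximally mixed state. -/
lemma sum_swapOn_sub {n : ℕ} (S : Finset (Fin n)) (a : Qubits n → ℂ) :
    ∑ x : Qubits n × Qubits n, a (swapOn S x).1 * a (swapOn S x).2 * star (a x.1 * a x.2) -
        (1 / 2 ^ S.card) *
          ∑ x : Qubits n × Qubits n, a x.1 * a x.2 * star (a x.1 * a x.2) =
      ∑ s, ∑ t, ((‖(marginal S (Matrix.vecMulVec a (star a)) -
        ((∑ x, a x * star (a x)) / 2 ^ S.card) • 1) s t‖ ^ 2 : ℝ) : ℂ) := by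
  set N : ℂ := ∑ x, a x * star (a x) with hN
  set R := marginal S (Matrix.vecMulVec a (star a)) with hR
  have hNstar : star N = N := by simp [hN, mul_comm]
  have h1 : ∑ x : Qubits n × Qubits n, a x.1 * a x.2 * star (a x.1 * a x.2) = N * N := by
    rw [hN, Finset.sum_mul_sum, Fintype.sum_prod_type]
    refine Finset.sum_congr rfl fun x _ => Finset.sum_congr rfl fun y _ => ?_
    rw [star_mul']
    ring
  have hcard : (Fintype.card ({i // i ∈ S} → Fin 2) : ℂ) = 2 ^ S.card := by simp
  have h2 : ∀ s t, ((‖(R - (N / 2 ^ S.card) • 1) s t‖ ^ 2 : ℝ) : ℂ) = R s t * star (R s t) +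
      if s = t then -(N / 2 ^ S.card) * R s s - (N / 2 ^ S.card) * star (R s s) +
        (N / 2 ^ S.card) * (N / 2 ^ S.card) else 0 := by
    intro s t
    rw [Complex.ofReal_pow, ← Complex.mul_conj', starRingEnd_apply]
    by_cases h : s = t
    · subst h
      simp only [Matrix.sub_apply, Matrix.smul_apply, Matrix.one_apply_eq, smul_eq_mul, mul_one,
        star_sub, star_div₀, hNstar, star_pow, star_ofNat, if_true]
      ring
    · simp [h]
  simp only [h2, Finset.sum_add_distrib, Finset.sum_ite_eq, Finset.mem_univ, if_true,
    Finset.sum_sub_distrib, ← Finset.mul_sum, ← star_sum]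
  rw [hR, sum_marginal_diag, ← hN, hNstar, sum_swapOn_eq, h1, Finset.sum_const, Finset.card_univ,
    nsmul_eq_mul, hcard]
  field_simp
  ring

/-- Summed over `j`, the squared norms of the vectors `c j - c j ∘ swap` give twice the difference
of the two traces, so each vanishes. -/
lemma eq_swap_of_swapTrace {n : ℕ} {ι : Type} [Fintype ι]
    {Φ : Matrix (Qubits n × Qubits n) (Qubits n × Qubits n) ℂ}
    {c : ι → Qubits n × Qubits n → ℂ} (hc : ∀ x y, Φ x y = ∑ j, c j x * star (c j y))
    (h : swapTrace Finset.univ Φ = swapTrace ∅ Φ) (j : ι) (x : Qubits n × Qubits n) :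
    c j x = c j x.swap := by
  have key : ∀ j, ∑ x, ((‖c j x - c j x.swap‖ ^ 2 : ℝ) : ℂ) =
      2 * (∑ x, c j x * star (c j x) - ∑ x, c j x.swap * star (c j x)) := by
    intro j
    have h1 : ∑ x : Qubits n × Qubits n, c j x.swap * star (c j x.swap) =
        ∑ x, c j x * star (c j x) :=
      (Equiv.prodComm (Qubits n) (Qubits n)).sum_comp fun x => c j x * star (c j x)
    have h2 : ∑ x : Qubits n × Qubits n, c j x * star (c j x.swap) =
        ∑ x, c j x.swap * star (c j x) :=
      (Equiv.prodComm (Qubits n) (Qubits n)).sum_comp fun x => c j x.swap * star (c j x)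
    have h3 : ∀ x : Qubits n × Qubits n, ((‖c j x - c j x.swap‖ ^ 2 : ℝ) : ℂ) =
        c j x * star (c j x) - c j x * star (c j x.swap) - c j x.swap * star (c j x) +
          c j x.swap * star (c j x.swap) := by
      intro x
      rw [Complex.ofReal_pow, ← Complex.mul_conj', starRingEnd_apply, star_sub]
      ring
    simp only [h3, Finset.sum_add_distrib, Finset.sum_sub_distrib, h1, h2]
    ring
  have hsum : ∑ j, ∑ x, ‖c j x - c j x.swap‖ ^ 2 = 0 := by
    rw [← Complex.ofReal_inj]
    simp only [Complex.ofReal_sum, key, ← Finset.mul_sum, Finset.sum_sub_distrib]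
    simp only [swapTrace, swapOn_univ, swapOn_empty, hc] at h
    rw [Finset.sum_comm, ← h, Finset.sum_comm]
    simp
  rw [Finset.sum_eq_zero_iff_of_nonneg fun j _ => Finset.sum_nonneg fun x _ => by positivity]
    at hsum
  have := (Finset.sum_eq_zero_iff_of_nonneg fun x _ => by positivity).1
    (hsum j (Finset.mem_univ j)) x (Finset.mem_univ x)
  exact sub_eq_zero.1 (by simpa using this)

lemma exists_smul_of_symm {α : Type*} {a b : α → ℂ} (h : ∀ x y, a x * b y = a y * b x) :
    ∃ l : ℂ, ∀ x y, a x * b y = l * (a x * a y) := by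
  by_cases ha : a = 0
  · exact ⟨0, by simp [ha]⟩
  · obtain ⟨z, hz⟩ := Function.ne_iff.1 ha
    refine ⟨b z / a z, fun x y => ?_⟩
    have hz' : a z ≠ 0 := hz
    field_simp
    linear_combination a x * h z y

/-- By `sum_swapOn_sub` the hypothesis says that a sum of squared distances to the maximally mixed
operator, weighted by `‖l j‖ ^ 2`, is zero. -/
lemma marginal_of_swapTrace {n : ℕ} {ι : Type} [Fintype ι]
    {Φ : Matrix (Qubits n × Qubits n) (Qubits n × Qubits n) ℂ}
    {l : ι → ℂ} {a : ι → Qubits n → ℂ}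
    (hc : ∀ x y, Φ x y =
      ∑ j, l j * (a j x.1 * a j x.2) * star (l j * (a j y.1 * a j y.2)))
    {S : Finset (Fin n)} (h : swapTrace S Φ = (1 / 2 ^ S.card) * swapTrace ∅ Φ) {j : ι}
    (hj : l j ≠ 0) :
    marginal S (Matrix.vecMulVec (a j) (star (a j))) =
      ((∑ x, a j x * star (a j x)) / 2 ^ S.card) • 1 := by
  have hsum : ∑ j, ‖l j‖ ^ 2 * ∑ s, ∑ t, ‖(marginal S (Matrix.vecMulVec (a j) (star (a j))) -
        ((∑ x, a j x * star (a j x)) / 2 ^ S.card) • 1) s t‖ ^ 2 = 0 := by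
    rw [← Complex.ofReal_inj]
    simp only [Complex.ofReal_sum, Complex.ofReal_mul]
    simp only [← sum_swapOn_sub]
    have hterm : ∀ T : Finset (Fin n), swapTrace T Φ = ∑ j, ((‖l j‖ ^ 2 : ℝ) : ℂ) *
        ∑ x, a j (swapOn T x).1 * a j (swapOn T x).2 * star (a j x.1 * a j x.2) := by
      intro T
      simp only [swapTrace, hc]
      rw [Finset.sum_comm]
      refine Finset.sum_congr rfl fun j _ => ?_
      rw [Finset.mul_sum]
      refine Finset.sum_congr rfl fun x _ => ?_
      rw [Complex.ofReal_pow, ← Complex.mul_conj', starRingEnd_apply, star_mul' (l j)]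
      ring
    rw [hterm, hterm ∅, ← sub_eq_zero, Finset.mul_sum, ← Finset.sum_sub_distrib] at h
    rw [Complex.ofReal_zero, ← h]
    refine Finset.sum_congr rfl fun j _ => ?_
    simp only [swapOn_empty]
    ring
  rw [Finset.sum_eq_zero_iff_of_nonneg fun j _ => by positivity] at hsum
  have h0 := (mul_eq_zero.1 (hsum j (Finset.mem_univ j))).resolve_left (by simpa using hj)
  rw [Finset.sum_eq_zero_iff_of_nonneg fun j _ => by positivity] at h0
  ext s t
  have h1 := (Finset.sum_eq_zero_iff_of_nonneg fun x _ => by positivity).1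
    (h0 s (Finset.mem_univ s)) t (Finset.mem_univ t)
  exact sub_eq_zero.1 (by simpa using h1)

theorem phiE8_not_isSeparable : ¬ IsSeparable phiE8 := by
  intro h
  obtain ⟨ι, _, a, b, hab⟩ := h.exists_vectors
  have hsymm := eq_swap_of_swapTrace (c := fun j x => a j x.1 * b j x.2) hab
    (swapTrace_phiE8_univ.trans swapTrace_phiE8_empty.symm)
  choose l hl using fun j => exists_smul_of_symm (a := a j) (b := b j) fun x y => hsymm j (x, y)
  simp only [hl] at hab
  have hzero : ∀ j x y, l j * (a j x * a j y) = 0 := by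
    intro j x y
    by_cases hj : l j = 0
    · simp [hj]
    by_cases hN : ∑ x, a j x * star (a j x) = 0
    · have hN' : ∑ x, ‖a j x‖ ^ 2 = 0 := by
        rw [← Complex.ofReal_inj, Complex.ofReal_sum, Complex.ofReal_zero, ← hN]
        exact Finset.sum_congr rfl fun x _ => by
          rw [Complex.ofReal_pow, ← Complex.mul_conj', starRingEnd_apply]
      have := (Finset.sum_eq_zero_iff_of_nonneg fun x _ => by positivity).1 hN' x
        (Finset.mem_univ x)
      have hx : a j x = 0 := by simpa using this
      simp [hx]
    · have : a j = 0 := eq_zero_of_marginal hN fun S hS => by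
        rw [← hS]
        refine marginal_of_swapTrace hab ?_ hj
        rw [swapTrace_phiE8_of_card_eq_three hS, swapTrace_phiE8_empty, hS]
        norm_num
      simp [this]
  have h1 := swapTrace_phiE8_empty
  simp [swapTrace, hab, hzero] at h1

end PhiE8

theorem mainTheorem1 :
    PhiE8.IsEntangled PhiE8.phiE8 ∧ ¬ ∃ ψ : PhiE8.Qubits 7 → ℂ, PhiE8.IsAME ψ := by
  exact ⟨⟨PhiE8.phiE8_isDensityMatrix, PhiE8.phiE8_not_isSeparable⟩,
    fun ⟨ψ, hψ⟩ => PhiE8.not_isAME_seven ψ hψ⟩
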